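/- Let $\mu_0$ be a probability measure on the Borel sets of $\mathbb{R}$ with finite fourth moment $\int x^4\,\mu_0(dx)<\infty$, and let $\sigma\ge 0$ be such that $\sigma^2=\int x^2\,\mu_0(dx)$. Let $\tilde\mu_0(B)=\tfrac12\{\mu_0(B)+\mu_0(-B)\}$ be its symmetrized form and suppose that the fourth cumulant $\kappa_4(\tilde\mu_0)$ is nonzero, where, for a probability measure $Q$ on $\mathbb{R}$ with finite fourth moment and mean $\bar Q=\int x\,Q(dx)$, $$\kappa_4(Q)=\int (x-\bar Q)^4\,Q(dx)-3\Big(\int (x-\bar Q)^2\,Q(dx)\Big)^2 .$$ A solution of the Kac equation with initial law $\mu_0$ is a family $(\mu(\cdot,t))_{t\ge 0}$ of probability measures on $\mathbb{R}$ with $\mu(\cdot,0)=\mu_0$ whose Fourier--Stieltjes transforms $\varphi(\xi,t)=\int e^{i\xi x}\,\mu(dx,t)$ are, for every $\xi\in\mathbb{R}$, continuous in $t\ge 0$, differentiable in $t>0$, and satisfy $$\frac{\partial\varphi}{\partial t}(\xi,t)=\frac1{2\pi}\int_0^{2\pi}\varphi(\xi\cos\theta,t)\,\varphi(\xi\sin\theta,t)\,d\theta-\varphi(\xi,t)\qquad(\xi\in\mathbb{R},\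 t>0).$$ Let $\gamma_\sigma$ be the Gaussian law with mean $0$ and variance $\sigma^2$ and let $d_{TV}(P,Q)=\sup_{B}|P(B)-Q(B)|$, the supremum being over all Borel sets $B\subseteq\mathbb{R}$. Then there is a constant $C>0$, depending only on $\mu_0$, such that for every solution $\mu(\cdot,t)$ of the Kac equation with initial law $\mu_0$ $$d_{TV}(\mu(\cdot,t),\gamma_\sigma)\ \ge\ C\,e^{-t/4}\qquad\text{for all } t\ge 0 .$$ Hence the rate $e^{-t/4}$ cannot be improved: there are no constant $D$ and function $\rho:\mathbb{R}\to\mathbb{R}$ with $\rho(t)\to 0$ as $t\to+\infty$ such that $d_{TV}(\mu(\cdot,t),\gamma_\sigma)\le D\,e^{-t/4}\rho(t)$ for all $t\ge 0$. -/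

import Mathlib

open MeasureTheory ProbabilityTheory Filter Topology
open scoped NNReal ENNReal

noncomputable section

namespace KacEquation

/-- Total variation distance between two (probability) measures on `ℝ`:
the supremum over Borel sets `B` of `|P(B) - Q(B)|`. -/
def dTV (P Q : Measure ℝ) : ℝ :=
  ⨆ B : {B : Set ℝ // MeasurableSet B}, |P.real B.1 - Q.real B.1|

/-- Symmetrized form of a measure: `B ↦ (μ(B) + μ(-B)) / 2`. -/
def symmetrization (μ : Measure ℝ) : Measure ℝ :=
  (2⁻¹ : ℝ≥0∞) • (μ + μ.map (fun x : ℝ => -x))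

/-- Fourth cumulant of a probability measure on `ℝ` with finite fourth moment. -/
def fourthCumulant (Q : Measure ℝ) : ℝ :=
  (∫ x, (x - ∫ y, y ∂Q) ^ 4 ∂Q) - 3 * (∫ x, (x - ∫ y, y ∂Q) ^ 2 ∂Q) ^ 2

/-- The family `(μ t)`, `t ≥ 0`, of probability measures on `ℝ` solves the Kac equation with
initial law `μ₀`, in Fourier form: the Fourier-Stieltjes transforms `φ(ξ, t)` are
continuous in `t ≥ 0`, start from that of `μ₀`, and for every real `ξ` and every `t > 0`
`∂φ/∂t (ξ, t) = (1 / 2π) ∫₀^{2π} φ(ξ cos θ, t) φ(ξ sin θ, t) dθ - φ(ξ, t)`. -/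
structure IsKacSolution (μ₀ : Measure ℝ) (μ : ℝ → Measure ℝ) : Prop where
  isProbabilityMeasure : ∀ t : ℝ, 0 ≤ t → IsProbabilityMeasure (μ t)
  initial : μ 0 = μ₀
  continuousOn : ∀ ξ : ℝ, ContinuousOn (fun t : ℝ => charFun (μ t) ξ) (Set.Ici 0)
  hasDerivAt : ∀ ξ t : ℝ, 0 < t →
    HasDerivAt (fun s : ℝ => charFun (μ s) ξ)
      ((1 / (2 * (Real.pi : ℂ))) *
          (∫ θ in (0 : ℝ)..(2 * Real.pi),
            charFun (μ t) (ξ * Real.cos θ) * charFun (μ t) (ξ * Real.sin θ))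
        - charFun (μ t) ξ) t

end KacEquation

end

/-! The real part `f` of the characteristic function again solves the Kac equation, and the Gaussian
transform `g` of variance `σ²` is stationary. At the origin `f₀ - g = kξ⁴ + o(ξ⁴)` with `k = κ₄/24 ≠
0`. Since `cos⁴ + sin⁴` has angular mean `3/4`, the linearized equation multiplies `ξ⁴` by `exp
(-t/4)`; the claim is that this mode survives in the nonlinear equation.

A comparison principle (`abs_le_exp_mul_of_comparison`) is applied twice. It first gives `|f - g| ≤
exp (-t/4) M ξ⁴` (`abs_sub_gauss_le`). The nonlinear corrections to the `ξ⁴` mode are then of size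
`exp (-t/4) ξ⁶`, and a second application gives `f - g = exp (-t/4) (kξ⁴ + error)`, with error at
most `εξ⁴ + Kξ⁶` uniformly in time (`abs_sub_gauss_sub_le`). At one small frequency, fixed by the
initial data alone, the main term wins. Total variation controls `f - g` at that frequency
(`abs_re_charFun_sub_le`). -/

namespace KacEquation

/-! ### Comparison principle. -/

/-- A function that is continuous on `[0, ∞)`, nonnegative at `0` and has nonnegative derivative on
`(0, ∞)` is nonnegative. -/
theorem nonneg_of_hasDerivAt_nonneg {W W' : ℝ → ℝ} (hc : ContinuousOn W (Set.Ici 0))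
    (hd : ∀ t, 0 < t → HasDerivAt W (W' t) t) (h' : ∀ t, 0 < t → 0 ≤ W' t) (h0 : 0 ≤ W 0)
    {t : ℝ} (ht : 0 ≤ t) : 0 ≤ W t := by
  have hm : MonotoneOn W (Set.Ici 0) := by
    refine monotoneOn_of_deriv_nonneg (convex_Ici 0) hc ?_ ?_
    · intro x hx
      rw [interior_Ici] at hx
      exact (hd x hx).differentiableAt.differentiableWithinAt
    · intro x hx
      rw [interior_Ici] at hx
      rw [(hd x hx).deriv]
      exact h' x hx
  exact h0.trans (hm Set.self_mem_Ici ht ht)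

/-- One Picard step of the comparison principle. -/
theorem abs_le_of_abs_deriv_add_self_le {v d : ℝ → ℝ} {b Q : ℝ} {n : ℕ} (hQ : 0 ≤ Q)
    (hcont : ContinuousOn v (Set.Ici 0)) (hder : ∀ t, 0 < t → HasDerivAt v (d t) t)
    (h0 : |v 0| ≤ b)
    (hstep : ∀ t, 0 < t → |d t + v t| ≤
      3 / 4 * Real.exp (-(1 / 4) * t) * b + 2 * (Q * ((2 * t) ^ n / n.factorial)))
    {t : ℝ} (ht : 0 ≤ t) :
    |v t| ≤ Real.exp (-(1 / 4) * t) * b + Q * ((2 * t) ^ (n + 1) / (n + 1).factorial) := by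
  -- The factor `exp t` turns `∂ₜ + 1` into a derivative; the sign `s` gives both sides of the
  -- absolute value.
  have key : ∀ s : ℝ, (s = 1 ∨ s = -1) →
      0 ≤ Real.exp t * (Real.exp (-(1 / 4) * t) * b +
        Q * ((2 * t) ^ (n + 1) / (n + 1).factorial) - s * v t) := by
    intro s hs
    have hE : ∀ t : ℝ, HasDerivAt Real.exp (Real.exp t) t := Real.hasDerivAt_exp
    have hB : ∀ t : ℝ, HasDerivAt (fun t : ℝ => Real.exp (-(1 / 4) * t) * b +
        Q * ((2 * t) ^ (n + 1) / (n + 1).factorial))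
        (Real.exp (-(1 / 4) * t) * (-(1 / 4)) * b +
          Q * (2 * ((2 * t) ^ n / n.factorial))) t := by
      intro t
      have h1 : HasDerivAt (fun t : ℝ => Real.exp (-(1 / 4) * t))
          (Real.exp (-(1 / 4) * t) * (-(1 / 4))) t := by
        simpa using ((hasDerivAt_id t).const_mul (-(1 / 4) : ℝ)).exp
      have h2 : HasDerivAt (fun t : ℝ => (2 * t) ^ (n + 1)) (((n + 1 : ℕ) : ℝ) * (2 * t) ^ n * 2) t := by
        convert! ((hasDerivAt_id t).const_mul (2 : ℝ)).pow (n + 1) using 1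
        simp
      convert! (h1.mul_const b).add ((h2.div_const ((n + 1).factorial : ℝ)).const_mul Q) using 1
      have : (n.factorial : ℝ) ≠ 0 := by positivity
      rw [Nat.factorial_succ]
      push_cast
      field_simp
    refine nonneg_of_hasDerivAt_nonneg
      (W := fun t => Real.exp t * (Real.exp (-(1 / 4) * t) * b +
        Q * ((2 * t) ^ (n + 1) / (n + 1).factorial) - s * v t)) ?_
      (fun t ht => (hE t).mul ((hB t).sub ((hder t ht).const_mul s))) ?_ ?_ ht
    · refine Real.continuous_exp.continuousOn.mul (ContinuousOn.sub ?_ (hcont.const_smul s))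
      exact fun t _ => (hB t).continuousAt.continuousWithinAt
    · intro t ht
      have hs1 : s * (d t + v t) ≤ |d t + v t| := by
        rcases hs with rfl | rfl
        · simpa using le_abs_self (d t + v t)
        · simpa using neg_abs_le (d t + v t) |> neg_le_neg
      have h3 := hs1.trans (hstep t ht)
      have h4 : 0 ≤ Q * ((2 * t) ^ (n + 1) / (n + 1).factorial) := by positivity
      rw [← mul_add]
      refine mul_nonneg (Real.exp_pos t).le ?_
      linarith
    · rcases hs with rfl | rfl
      · simpa using (le_abs_self (v 0)).trans h0
      · have := (neg_abs_le (v 0))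
        simp
        linarith
  have h1 := nonneg_of_mul_nonneg_right (key 1 (Or.inl rfl)) (Real.exp_pos t)
  have h2 := nonneg_of_mul_nonneg_right (key (-1) (Or.inr rfl)) (Real.exp_pos t)
  rw [abs_le]
  constructor <;> linarith

/-- Comparison principle: if the evolution `∂ₜ v + v` is controlled by a positive operator for which
`exp (-t / 4) b` is a supersolution, then a bounded `v` is dominated by `exp (-t / 4) b` as soon
as it is initially dominated by `b`. -/
theorem abs_le_exp_mul_of_comparison {v d : ℝ → ℝ → ℝ} {b : ℝ → ℝ} {Q : ℝ} {S : Set ℝ}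
    (hcont : ∀ ξ ∈ S, ContinuousOn (fun t => v t ξ) (Set.Ici 0))
    (hder : ∀ ξ ∈ S, ∀ t, 0 < t → HasDerivAt (fun s => v s ξ) (d t ξ) t)
    (h0 : ∀ ξ ∈ S, |v 0 ξ| ≤ b ξ)
    (hQ : ∀ t, 0 ≤ t → ∀ ξ ∈ S, |v t ξ| ≤ Q)
    (hstep : ∀ t, 0 < t → ∀ c, 0 ≤ c →
      (∀ η ∈ S, |v t η| ≤ Real.exp (-(1 / 4) * t) * b η + c) →
      ∀ ξ ∈ S, |d t ξ + v t ξ| ≤ 3 / 4 * Real.exp (-(1 / 4) * t) * b ξ + 2 * c)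
    {t ξ : ℝ} (ht : 0 ≤ t) (hξ : ξ ∈ S) :
    |v t ξ| ≤ Real.exp (-(1 / 4) * t) * b ξ := by
  have hQ0 : 0 ≤ Q := (abs_nonneg _).trans (hQ 0 le_rfl ξ hξ)
  -- Iterating from the crude bound `Q`, the excess over the supersolution becomes `Q (2t)ⁿ/n!`,
  -- which vanishes in the limit.
  have main : ∀ n : ℕ, ∀ t, 0 ≤ t → ∀ ξ ∈ S,
      |v t ξ| ≤ Real.exp (-(1 / 4) * t) * b ξ + Q * ((2 * t) ^ n / n.factorial) := by
    intro n
    induction n with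
    | zero =>
      intro t ht ξ hξ
      have hb : 0 ≤ b ξ := (abs_nonneg _).trans (h0 ξ hξ)
      have : 0 ≤ Real.exp (-(1 / 4) * t) * b ξ := by positivity
      have := hQ t ht ξ hξ
      simp only [pow_zero, Nat.factorial_zero, Nat.cast_one, div_one, mul_one]
      linarith
    | succ n ih =>
      intro t ht ξ hξ
      refine abs_le_of_abs_deriv_add_self_le hQ0 (hcont ξ hξ) (hder ξ hξ) (h0 ξ hξ) ?_ ht
      intro s hs
      exact hstep s hs _ (by positivity) (ih s hs.le) ξ hξ
  have hlim : Tendsto (fun n : ℕ => Real.exp (-(1 / 4) * t) * b ξ +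
      Q * ((2 * t) ^ n / n.factorial)) atTop (𝓝 (Real.exp (-(1 / 4) * t) * b ξ + Q * 0)) :=
    ((FloorSemiring.tendsto_pow_div_factorial_atTop (2 * t)).const_mul Q).const_add _
  rw [mul_zero, add_zero] at hlim
  exact ge_of_tendsto' hlim fun n => main n t ht ξ hξ

/-! ### Gaussian transform and angular averages. -/

/-- The Gaussian characteristic function, real form. -/
noncomputable def gauss (s ξ : ℝ) : ℝ := Real.exp (-(s * ξ ^ 2 / 2))

theorem gauss_cos_mul_gauss_sin (s ξ θ : ℝ) :
    gauss s (ξ * Real.cos θ) * gauss s (ξ * Real.sin θ) = gauss s ξ := by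
  unfold gauss
  rw [← Real.exp_add]
  congr 1
  linear_combination (-(s * ξ ^ 2 / 2)) * Real.sin_sq_add_cos_sq θ

theorem continuous_gauss (s : ℝ) : Continuous (gauss s) := by
  unfold gauss
  fun_prop

theorem abs_gauss_le_one {s : ℝ} (hs : 0 ≤ s) (ξ : ℝ) : |gauss s ξ| ≤ 1 := by
  unfold gauss
  rw [abs_of_pos (Real.exp_pos _), Real.exp_le_one_iff]
  have : 0 ≤ s * ξ ^ 2 / 2 := by positivity
  linarith

theorem abs_gauss_sub_one_le {s : ℝ} (hs : 0 ≤ s) (ξ : ℝ) : |gauss s ξ - 1| ≤ s * ξ ^ 2 / 2 := by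
  have h1 := (abs_le.1 (abs_gauss_le_one hs ξ)).2
  rw [abs_of_nonpos (by linarith)]
  have := Real.one_sub_le_exp_neg (s * ξ ^ 2 / 2)
  unfold gauss
  linarith

/-- The Kac equation for real-valued (even parts of) characteristic functions. -/
structure IsRealKacSolution (f₀ : ℝ → ℝ) (f : ℝ → ℝ → ℝ) : Prop where
  initial : f 0 = f₀
  abs_le_one : ∀ t, 0 ≤ t → ∀ ξ, |f t ξ| ≤ 1
  continuous : ∀ t, 0 ≤ t → Continuous (f t)
  continuousOn : ∀ ξ, ContinuousOn (fun t => f t ξ) (Set.Ici 0)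
  hasDerivAt : ∀ ξ t, 0 < t → HasDerivAt (fun s => f s ξ)
    (1 / (2 * Real.pi) * (∫ θ in (0 : ℝ)..(2 * Real.pi),
      f t (ξ * Real.cos θ) * f t (ξ * Real.sin θ)) - f t ξ) t

theorem abs_mul_cos_le (ξ θ : ℝ) : |ξ * Real.cos θ| ≤ |ξ| := by
  rw [abs_mul]
  exact mul_le_of_le_one_right (abs_nonneg _) (Real.abs_cos_le_one θ)

theorem abs_mul_sin_le (ξ θ : ℝ) : |ξ * Real.sin θ| ≤ |ξ| := by
  rw [abs_mul]
  exact mul_le_of_le_one_right (abs_nonneg _) (Real.abs_sin_le_one θ)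

/-- Angular averages of functions dominated by `A + B sin² θ cos² θ`. -/
theorem abs_average_le {F : ℝ → ℝ} {A B : ℝ}
    (h : ∀ θ, |F θ| ≤ A + B * (Real.sin θ ^ 2 * Real.cos θ ^ 2)) :
    |1 / (2 * Real.pi) * ∫ θ in (0 : ℝ)..(2 * Real.pi), F θ| ≤ A + B / 8 := by
  have hpi := Real.pi_pos
  have h1 : |∫ θ in (0 : ℝ)..(2 * Real.pi), F θ| ≤
      ∫ θ in (0 : ℝ)..(2 * Real.pi), (A + B * (Real.sin θ ^ 2 * Real.cos θ ^ 2)) := by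
    refine intervalIntegral.norm_integral_le_of_norm_le (f := F)
      (g := fun θ => A + B * (Real.sin θ ^ 2 * Real.cos θ ^ 2)) (by positivity)
      (Eventually.of_forall fun θ _ => h θ) (Continuous.intervalIntegrable (by fun_prop) _ _)
  have h2 : ∫ θ in (0 : ℝ)..(2 * Real.pi), (A + B * (Real.sin θ ^ 2 * Real.cos θ ^ 2)) =
      2 * Real.pi * (A + B / 8) := by
    rw [intervalIntegral.integral_add (Continuous.intervalIntegrable (by fun_prop) _ _)
      (Continuous.intervalIntegrable (by fun_prop) _ _), intervalIntegral.integral_const_mul,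
      integral_sin_sq_mul_cos_sq]
    have h8 : Real.sin (4 * (2 * Real.pi)) = 0 := by
      have := Real.sin_nat_mul_pi 8
      push_cast at this
      rw [← this]
      ring_nf
    simp [h8]
    ring
  rw [abs_mul, abs_of_pos (by positivity)]
  calc 1 / (2 * Real.pi) * |∫ θ in (0 : ℝ)..(2 * Real.pi), F θ|
      ≤ 1 / (2 * Real.pi) * (2 * Real.pi * (A + B / 8)) := by
        rw [← h2]; gcongr
    _ = A + B / 8 := by field_simp

/-- The angular average of `k (ξ cos θ)⁴ + k (ξ sin θ)⁴` is `3 / 4 k ξ⁴`. -/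
theorem average_fourth_pow (k ξ : ℝ) :
    1 / (2 * Real.pi) * ∫ θ in (0 : ℝ)..(2 * Real.pi),
      (k * (ξ * Real.cos θ) ^ 4 + k * (ξ * Real.sin θ) ^ 4) = 3 / 4 * (k * ξ ^ 4) := by
  have hpi := Real.pi_pos
  have h2 : ∫ θ in (0 : ℝ)..(2 * Real.pi),
      (k * (ξ * Real.cos θ) ^ 4 + k * (ξ * Real.sin θ) ^ 4) =
      2 * Real.pi * (3 / 4 * (k * ξ ^ 4)) := by
    have h3 : ∀ θ : ℝ, k * (ξ * Real.cos θ) ^ 4 + k * (ξ * Real.sin θ) ^ 4 =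
        k * ξ ^ 4 + (-(2 * (k * ξ ^ 4))) * (Real.sin θ ^ 2 * Real.cos θ ^ 2) := by
      intro θ
      linear_combination k * ξ ^ 4 * (Real.sin θ ^ 2 + Real.cos θ ^ 2 + 1) *
        Real.sin_sq_add_cos_sq θ
    simp_rw [h3]
    rw [intervalIntegral.integral_add (Continuous.intervalIntegrable (by fun_prop) _ _)
      (Continuous.intervalIntegrable (by fun_prop) _ _), intervalIntegral.integral_const_mul (-(2 * (k * ξ ^ 4))),
      integral_sin_sq_mul_cos_sq]
    have h8 : Real.sin (4 * (2 * Real.pi)) = 0 := by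
      have := Real.sin_nat_mul_pi 8
      push_cast at this
      rw [← this]
      ring_nf
    simp [h8]
    ring
  rw [h2]
  field_simp

/-! ### Upper bound and leading term of the deviation. -/

namespace IsRealKacSolution

variable {f₀ : ℝ → ℝ} {f : ℝ → ℝ → ℝ}

/-- Stationarity of the Gaussian lets the difference of products be telescoped as `u·f + g·u`,
linear in the deviation `u` with coefficients bounded by 1. -/
theorem hasDerivAt_sub_gauss (hf : IsRealKacSolution f₀ f) (s ξ : ℝ) {t : ℝ} (ht : 0 < t) :
    HasDerivAt (fun r => f r ξ - gauss s ξ)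
      (1 / (2 * Real.pi) * (∫ θ in (0 : ℝ)..(2 * Real.pi),
        ((f t (ξ * Real.cos θ) - gauss s (ξ * Real.cos θ)) * f t (ξ * Real.sin θ) +
        gauss s (ξ * Real.cos θ) * (f t (ξ * Real.sin θ) - gauss s (ξ * Real.sin θ))))
        - (f t ξ - gauss s ξ)) t := by
  have hpi := Real.pi_pos
  convert! (hf.hasDerivAt ξ t ht).sub_const (gauss s ξ) using 1
  have hc := hf.continuous t ht.le
  have h1 : ∀ θ : ℝ,
      (f t (ξ * Real.cos θ) - gauss s (ξ * Real.cos θ)) * f t (ξ * Real.sin θ) +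
        gauss s (ξ * Real.cos θ) * (f t (ξ * Real.sin θ) - gauss s (ξ * Real.sin θ)) =
      f t (ξ * Real.cos θ) * f t (ξ * Real.sin θ) - gauss s ξ := by
    intro θ
    rw [← gauss_cos_mul_gauss_sin s ξ θ]
    ring
  rw [intervalIntegral.integral_congr fun θ _ => h1 θ, intervalIntegral.integral_sub (Continuous.intervalIntegrable (by fun_prop) _ _)
    (Continuous.intervalIntegrable (by fun_prop) _ _)]
  simp
  field_simp
  ring

theorem abs_sub_gauss_le_two (hf : IsRealKacSolution f₀ f) {s : ℝ} (hs : 0 ≤ s) {t : ℝ}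
    (ht : 0 ≤ t) (ξ : ℝ) : |f t ξ - gauss s ξ| ≤ 2 := by
  have h1 := hf.abs_le_one t ht ξ
  have h2 := abs_gauss_le_one hs ξ
  have h3 := abs_sub (f t ξ) (gauss s ξ)
  linarith

/-- Exponential contraction in the Fourier distance of order four. -/
theorem abs_sub_gauss_le (hf : IsRealKacSolution f₀ f) {s M : ℝ} (hs : 0 ≤ s)
    (h0 : ∀ ξ, |f₀ ξ - gauss s ξ| ≤ M * ξ ^ 4) {t : ℝ} (ht : 0 ≤ t) (ξ : ℝ) :
    |f t ξ - gauss s ξ| ≤ Real.exp (-(1 / 4) * t) * (M * ξ ^ 4) := by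
  refine abs_le_exp_mul_of_comparison (v := fun t ξ => f t ξ - gauss s ξ)
    (b := fun ξ => M * ξ ^ 4) (Q := 2) (S := Set.univ)
    (fun ξ _ => (hf.continuousOn ξ).sub continuousOn_const)
    (fun ξ _ t ht => hf.hasDerivAt_sub_gauss s ξ ht) (fun ξ _ => by simpa [hf.initial] using h0 ξ)
    (fun t ht ξ _ => hf.abs_sub_gauss_le_two hs ht ξ) ?_ ht (Set.mem_univ ξ)
  intro t ht c _ hv ξ _
  simp only [sub_add_cancel]
  -- `cos⁴ + sin⁴ = 1 - 2 sin² cos²`, and `A + B/8` yields the factor `3/4`.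
  refine (abs_average_le (A := Real.exp (-(1 / 4) * t) * (M * ξ ^ 4) + 2 * c)
    (B := -(2 * (Real.exp (-(1 / 4) * t) * (M * ξ ^ 4)))) fun θ => ?_).trans
    (le_of_eq (by ring))
  have h1 := hv (ξ * Real.cos θ) trivial
  have h2 := hv (ξ * Real.sin θ) trivial
  have h3 := hf.abs_le_one t ht.le (ξ * Real.sin θ)
  have h4 := abs_gauss_le_one hs (ξ * Real.cos θ)
  refine (abs_add_le _ _).trans ?_
  rw [abs_mul, abs_mul]
  refine (add_le_add (mul_le_of_le_one_right (abs_nonneg _) h3)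
    (mul_le_of_le_one_left (abs_nonneg _) h4)).trans ((add_le_add h1 h2).trans (le_of_eq ?_))
  linear_combination Real.exp (-(1 / 4) * t) * M * ξ ^ 4 * (Real.sin θ ^ 2 + Real.cos θ ^ 2 + 1) *
    Real.sin_sq_add_cos_sq θ

theorem abs_sub_one_le (hf : IsRealKacSolution f₀ f) {s M : ℝ} (hs : 0 ≤ s) (hM : 0 ≤ M)
    (h0 : ∀ ξ, |f₀ ξ - gauss s ξ| ≤ M * ξ ^ 4) {t : ℝ} (ht : 0 ≤ t) {ξ : ℝ} (hξ : |ξ| ≤ 1) :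
    |f t ξ - 1| ≤ (M + s) * ξ ^ 2 := by
  have h1 := hf.abs_sub_gauss_le hs h0 ht ξ
  have h2 := abs_gauss_sub_one_le hs ξ
  have h3 : Real.exp (-(1 / 4) * t) ≤ 1 := Real.exp_le_one_iff.2 (by linarith)
  have h4 : ξ ^ 2 ≤ 1 := by rw [← sq_abs]; exact pow_le_one₀ (abs_nonneg _) hξ
  have h5 : Real.exp (-(1 / 4) * t) * (M * ξ ^ 4) ≤ M * ξ ^ 2 := by
    calc Real.exp (-(1 / 4) * t) * (M * ξ ^ 4) ≤ 1 * (M * (ξ ^ 2 * ξ ^ 2)) := by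
          rw [← pow_add]; gcongr
      _ ≤ 1 * (M * (ξ ^ 2 * 1)) := by gcongr
      _ = M * ξ ^ 2 := by ring
  have h6 := abs_sub_le (f t ξ) (gauss s ξ) 1
  have h7 : 0 ≤ s * ξ ^ 2 := by positivity
  linarith

/-- The deviation from the Gaussian is, to fourth order at the origin and uniformly in time,
`exp (-t / 4) k ξ⁴`. -/
theorem abs_sub_gauss_sub_le (hf : IsRealKacSolution f₀ f) {s M k ε K : ℝ} (hs : 0 ≤ s)
    (hM : 0 ≤ M) (h0 : ∀ ξ, |f₀ ξ - gauss s ξ| ≤ M * ξ ^ 4)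
    (h1 : ∀ ξ, |ξ| ≤ 1 → |f₀ ξ - gauss s ξ - k * ξ ^ 4| ≤ ε * ξ ^ 4 + K * ξ ^ 6)
    (hK : M * (M + s) ≤ K) {t : ℝ} (ht : 0 ≤ t) {ξ : ℝ} (hξ : |ξ| ≤ 1) :
    |f t ξ - gauss s ξ - Real.exp (-(1 / 4) * t) * (k * ξ ^ 4)| ≤
      Real.exp (-(1 / 4) * t) * (ε * ξ ^ 4 + K * ξ ^ 6) := by
  have hexp : ∀ t : ℝ, HasDerivAt (fun t : ℝ => Real.exp (-(1 / 4) * t))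
      (Real.exp (-(1 / 4) * t) * (-(1 / 4))) t := by
    intro t
    simpa using ((hasDerivAt_id t).const_mul (-(1 / 4) : ℝ)).exp
  refine abs_le_exp_mul_of_comparison
    (v := fun t ξ => f t ξ - gauss s ξ - Real.exp (-(1 / 4) * t) * (k * ξ ^ 4))
    (b := fun ξ => ε * ξ ^ 4 + K * ξ ^ 6) (Q := 2 + |k|) (S := {ξ | |ξ| ≤ 1})
    (fun ξ _ => ((hf.continuousOn ξ).sub continuousOn_const).sub (by fun_prop))
    (fun ξ _ t ht => (hf.hasDerivAt_sub_gauss s ξ ht).sub ((hexp t).mul_const (k * ξ ^ 4)))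
    (fun ξ hξ => by simpa [hf.initial] using h1 ξ hξ) ?_ ?_ ht hξ
  · intro t ht ξ hξ
    have h2 := hf.abs_sub_gauss_le_two hs ht ξ
    have h3 := abs_sub (f t ξ - gauss s ξ) (Real.exp (-(1 / 4) * t) * (k * ξ ^ 4))
    have h4 : |Real.exp (-(1 / 4) * t) * (k * ξ ^ 4)| ≤ 1 * (|k| * 1) := by
      rw [abs_mul, abs_mul, abs_pow, abs_of_pos (Real.exp_pos _)]
      have := Real.exp_le_one_iff.2 (show -(1 / 4) * t ≤ 0 by linarith)
      have := pow_le_one₀ (n := 4) (abs_nonneg ξ) hξ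
      gcongr
    linarith
  intro t ht c _ hv ξ hξ
  set e := Real.exp (-(1 / 4) * t) with he
  have hc := hf.continuous t ht.le
  have hg := continuous_gauss s
  have hw := average_fourth_pow (e * k) ξ
  -- The subtracted mode solves the linearized equation exactly, so it can be moved under the
  -- angular integral.
  have hrew : (1 / (2 * Real.pi) * (∫ θ in (0 : ℝ)..(2 * Real.pi),
        ((f t (ξ * Real.cos θ) - gauss s (ξ * Real.cos θ)) * f t (ξ * Real.sin θ) +
        gauss s (ξ * Real.cos θ) * (f t (ξ * Real.sin θ) - gauss s (ξ * Real.sin θ))))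
        - (f t ξ - gauss s ξ) - e * (-(1 / 4)) * (k * ξ ^ 4)) +
        (f t ξ - gauss s ξ - e * (k * ξ ^ 4)) =
      1 / (2 * Real.pi) * ∫ θ in (0 : ℝ)..(2 * Real.pi),
        ((f t (ξ * Real.cos θ) - gauss s (ξ * Real.cos θ)) * f t (ξ * Real.sin θ) +
        gauss s (ξ * Real.cos θ) * (f t (ξ * Real.sin θ) - gauss s (ξ * Real.sin θ)) -
        (e * k * (ξ * Real.cos θ) ^ 4 + e * k * (ξ * Real.sin θ) ^ 4)) := by
    rw [intervalIntegral.integral_sub (Continuous.intervalIntegrable (by fun_prop) _ _)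
      (Continuous.intervalIntegrable (by fun_prop) _ _), mul_sub, hw]
    ring
  rw [hrew]
  -- With `x = ξ cos θ`, `y = ξ sin θ` and `p = sin² θ cos² θ`: `x⁴ + y⁴ = ξ⁴(1 - 2p)`, `x⁶ + y⁶ =
  -- ξ⁶(1 - 3p)`, `x⁴y² + x²y⁴ = ξ⁶p`. The sextic average is `5K/8 + M(M+s)/8`, at most `3K/4`
  -- precisely because `M(M+s) ≤ K`.
  refine (abs_average_le (A := e * (ε * ξ ^ 4 + K * ξ ^ 6) + 2 * c)
    (B := e * (-(2 * (ε * ξ ^ 4)) - 3 * (K * ξ ^ 6) + M * (M + s) * ξ ^ 6)) fun θ => ?_).trans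
    ?_
  · set x := ξ * Real.cos θ with hx
    set y := ξ * Real.sin θ with hy
    have hx1 : |x| ≤ 1 := (abs_mul_cos_le ξ θ).trans hξ
    have hy1 : |y| ≤ 1 := (abs_mul_sin_le ξ θ).trans hξ
    have hvx : |f t x - gauss s x - e * (k * x ^ 4)| ≤ _ := hv x hx1
    have hvy : |f t y - gauss s y - e * (k * y ^ 4)| ≤ _ := hv y hy1
    have hux := hf.abs_sub_gauss_le hs h0 ht.le x
    have huy := hf.abs_sub_gauss_le hs h0 ht.le y
    have hfy := hf.abs_sub_one_le hs hM h0 ht.le hy1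
    have hgx : |gauss s x - 1| ≤ (M + s) * x ^ 2 := by
      refine (abs_gauss_sub_one_le hs x).trans ?_
      have : 0 ≤ s * x ^ 2 := by positivity
      have : 0 ≤ M * x ^ 2 := by positivity
      linarith
    have e1 : |(f t x - gauss s x) * (f t y - 1)| ≤
        e * (M * x ^ 4) * ((M + s) * y ^ 2) := by
      rw [abs_mul]
      exact mul_le_mul hux hfy (abs_nonneg _) (by positivity)
    have e2 : |(gauss s x - 1) * (f t y - gauss s y)| ≤
        (M + s) * x ^ 2 * (e * (M * y ^ 4)) := by
      rw [abs_mul]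
      exact mul_le_mul hgx huy (abs_nonneg _) (by positivity)
    have hsplit : (f t x - gauss s x) * f t y + gauss s x * (f t y - gauss s y) -
        (e * k * x ^ 4 + e * k * y ^ 4) =
        (f t x - gauss s x - e * (k * x ^ 4)) + (f t y - gauss s y - e * (k * y ^ 4)) +
        ((f t x - gauss s x) * (f t y - 1) + (gauss s x - 1) * (f t y - gauss s y)) := by ring
    rw [hsplit]
    refine (abs_add_le _ _).trans ((add_le_add ((abs_add_le _ _).trans (add_le_add hvx hvy))
      ((abs_add_le _ _).trans (add_le_add e1 e2))).trans ?_)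
    have hS : Real.sin θ ^ 2 = 1 - Real.cos θ ^ 2 := by
      linarith [Real.sin_sq_add_cos_sq θ]
    have hS4 : Real.sin θ ^ 4 = (1 - Real.cos θ ^ 2) ^ 2 := by rw [← hS]; ring
    have hS6 : Real.sin θ ^ 6 = (1 - Real.cos θ ^ 2) ^ 3 := by rw [← hS]; ring
    refine le_of_eq ?_
    rw [hx, hy]
    simp only [mul_pow, hS, hS4, hS6]
    ring
  · have h6 : 0 ≤ e * ξ ^ 6 := by
      have : (0 : ℝ) ≤ ξ ^ 6 := by positivity
      positivity
    have := mul_le_mul_of_nonneg_left hK h6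
    linarith

end IsRealKacSolution

/-! ### Lower bound at one frequency. -/

/-- If the initial datum deviates from the Gaussian by `k ξ⁴ + o(ξ⁴)`, `k ≠ 0`, then at a suitable
frequency every solution stays away from the Gaussian by a multiple of `exp (-t / 4)`. -/
theorem exists_exp_le_abs_sub_gauss {f₀ : ℝ → ℝ} {s k : ℝ} (hs : 0 ≤ s) (hk : k ≠ 0)
    (hf₀ : ∀ ξ, |f₀ ξ| ≤ 1)
    (ho : (fun ξ => f₀ ξ - gauss s ξ - k * ξ ^ 4) =o[𝓝 0] fun ξ : ℝ => ξ ^ 4) :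
    ∃ ξ c : ℝ, 0 < c ∧ ∀ f, IsRealKacSolution f₀ f → ∀ t, 0 ≤ t →
      c * Real.exp (-(1 / 4) * t) ≤ |f t ξ - gauss s ξ| := by
  have hk' : 0 < |k| := abs_pos.2 hk
  obtain ⟨δ, hδ, hball⟩ := Metric.eventually_nhds_iff.1 (ho.def (c := |k| / 4) (by positivity))
  have hnear : ∀ ξ, |ξ| < δ → |f₀ ξ - gauss s ξ - k * ξ ^ 4| ≤ |k| / 4 * ξ ^ 4 := by
    intro ξ hξ
    have := hball (y := ξ) (by simpa using hξ)
    rwa [Real.norm_eq_abs, Real.norm_eq_abs, abs_of_nonneg (by positivity : (0 : ℝ) ≤ ξ ^ 4)] at this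
  -- The first term serves `|ξ| < δ`; the second serves `|ξ| ≥ δ`, where the deviation is at most 2.
  set M : ℝ := 2 * |k| + 2 / δ ^ 4 with hMdef
  have hM : 0 ≤ M := by positivity
  have h0 : ∀ ξ, |f₀ ξ - gauss s ξ| ≤ M * ξ ^ 4 := by
    intro ξ
    have hp : (0 : ℝ) ≤ ξ ^ 4 := by positivity
    rcases lt_or_ge |ξ| δ with h | h
    · have h1 := hnear ξ h
      have h2 := abs_sub_abs_le_abs_sub (f₀ ξ - gauss s ξ) (k * ξ ^ 4)
      rw [abs_mul, abs_of_nonneg hp] at h2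
      have h3 : 0 ≤ 2 / δ ^ 4 * ξ ^ 4 := by positivity
      have h4 : 0 ≤ |k| * ξ ^ 4 := by positivity
      rw [hMdef, add_mul]
      linarith
    · have h1 := hf₀ ξ
      have h2 := abs_gauss_le_one hs ξ
      have h3 := abs_sub (f₀ ξ) (gauss s ξ)
      have h4 : 2 ≤ 2 / δ ^ 4 * ξ ^ 4 := by
        rw [div_mul_eq_mul_div, le_div_iff₀ (by positivity)]
        have := pow_le_pow_left₀ hδ.le h 4
        rw [pow_abs, abs_of_nonneg hp] at this
        linarith
      have h5 : 0 ≤ |k| * ξ ^ 4 := by positivity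
      rw [hMdef, add_mul]
      linarith
  -- The second term covers `|ξ| ≥ δ`, where `ξ⁴ ≤ ξ⁶/δ²`.
  set K : ℝ := M * (M + s) + (M + |k|) / δ ^ 2 with hKdef
  have hMs : 0 ≤ M * (M + s) := by positivity
  have hq : 0 ≤ (M + |k|) / δ ^ 2 := by positivity
  have hK : 0 ≤ K := by positivity
  have h1 : ∀ ξ, |ξ| ≤ 1 → |f₀ ξ - gauss s ξ - k * ξ ^ 4| ≤ |k| / 4 * ξ ^ 4 + K * ξ ^ 6 := by
    intro ξ _
    have hp : (0 : ℝ) ≤ ξ ^ 4 := by positivity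
    have hp6 : (0 : ℝ) ≤ ξ ^ 6 := by positivity
    rcases lt_or_ge |ξ| δ with h | h
    · have := hnear ξ h
      have : 0 ≤ K * ξ ^ 6 := by positivity
      linarith
    · have h2 := h0 ξ
      have h3 := abs_sub (f₀ ξ - gauss s ξ) (k * ξ ^ 4)
      rw [abs_mul, abs_of_nonneg hp] at h3
      have h4 : (M + |k|) * ξ ^ 4 ≤ (M + |k|) / δ ^ 2 * ξ ^ 6 := by
        have h5 := pow_le_pow_left₀ hδ.le h 2
        rw [sq_abs] at h5
        rw [div_mul_eq_mul_div, le_div_iff₀ (by positivity)]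
        have := mul_le_mul_of_nonneg_left h5 (show 0 ≤ (M + |k|) * ξ ^ 4 by positivity)
        linarith
      have h6 : 0 ≤ M * (M + s) * ξ ^ 6 := by positivity
      have h7 : 0 ≤ |k| / 4 * ξ ^ 4 := by positivity
      rw [hKdef, add_mul]
      linarith
  -- The two errors, each at most `|k|/4 · x⁴`, leave half of the leading term.
  obtain ⟨x, hx0, hx1, hxK⟩ : ∃ x : ℝ, 0 < x ∧ x ≤ 1 ∧ K * x ^ 2 ≤ |k| / 4 := by
    refine ⟨min 1 (|k| / (4 * (K + 1))), by positivity, min_le_left _ _, ?_⟩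
    set x := min 1 (|k| / (4 * (K + 1)))
    have hx0 : 0 < x := by positivity
    have hx1 : x ≤ 1 := min_le_left _ _
    have hx2 : x ≤ |k| / (4 * (K + 1)) := min_le_right _ _
    rw [le_div_iff₀ (by positivity)] at hx2
    have : K * x ^ 2 ≤ K * x := by
      rw [sq]
      exact mul_le_mul_of_nonneg_left (mul_le_of_le_one_left hx0.le hx1) hK
    linarith
  refine ⟨x, |k| / 2 * x ^ 4, by positivity, fun f hf t ht => ?_⟩
  have h2 := hf.abs_sub_gauss_sub_le hs hM h0 h1 (by rw [hKdef]; linarith) ht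
    (show |x| ≤ 1 by rwa [abs_of_pos hx0])
  set e := Real.exp (-(1 / 4) * t) with he
  have he0 : 0 < e := Real.exp_pos _
  have h3 := abs_sub_abs_le_abs_sub (e * (k * x ^ 4)) (f t x - gauss s x)
  rw [abs_sub_comm (e * (k * x ^ 4)), abs_mul, abs_mul, abs_of_pos he0,
    abs_of_nonneg (by positivity : (0 : ℝ) ≤ x ^ 4)] at h3
  have h4 : e * (K * x ^ 6) ≤ e * (|k| / 4 * x ^ 4) := by
    have : K * x ^ 6 = K * x ^ 2 * x ^ 4 := by ring
    rw [this]
    gcongr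
  linarith

end KacEquation
namespace KacEquation

/-! ### Total variation and characteristic functions. -/

theorem bddAbove_abs_real_sub_real (P Q : Measure ℝ) [IsProbabilityMeasure P]
    [IsProbabilityMeasure Q] :
    BddAbove (Set.range fun B : {B : Set ℝ // MeasurableSet B} => |P.real B.1 - Q.real B.1|) := by
  refine ⟨1, ?_⟩
  rintro _ ⟨B, rfl⟩
  have h1 := measureReal_nonneg (μ := P) (s := B.1)
  have h2 := measureReal_le_one (μ := P) (s := B.1)
  have h3 := measureReal_nonneg (μ := Q) (s := B.1)
  have h4 := measureReal_le_one (μ := Q) (s := B.1)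
  exact abs_le.2 ⟨by linarith, by linarith⟩

theorem abs_real_sub_real_le_dTV (P Q : Measure ℝ) [IsProbabilityMeasure P]
    [IsProbabilityMeasure Q] {B : Set ℝ} (hB : MeasurableSet B) :
    |P.real B - Q.real B| ≤ dTV P Q :=
  le_ciSup (bddAbove_abs_real_sub_real P Q) ⟨B, hB⟩

/-- The layer cake formula for `[0, 1]`-valued functions. -/
theorem integral_eq_intervalIntegral_real_lt (P : Measure ℝ) [IsProbabilityMeasure P] {h : ℝ → ℝ}
    (hh : Measurable h) (h0 : ∀ x, 0 ≤ h x) (h1 : ∀ x, h x ≤ 1) :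
    ∫ x, h x ∂P = ∫ s in (0 : ℝ)..1, P.real {x | s < h x} := by
  have hi : Integrable h P := Integrable.of_bound hh.aestronglyMeasurable 1
    (Eventually.of_forall fun x => by rw [Real.norm_eq_abs, abs_of_nonneg (h0 x)]; exact h1 x)
  rw [hi.integral_eq_integral_meas_lt (Eventually.of_forall h0),
    intervalIntegral.integral_of_le zero_le_one]
  refine setIntegral_eq_of_subset_of_forall_sdiff_eq_zero measurableSet_Ioi
    Set.Ioc_subset_Ioi_self fun s hs => ?_
  have hs1 : 1 < s := by
    by_contra hcon
    exact hs.2 ⟨hs.1, not_lt.1 hcon⟩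
  have : {x | s < h x} = ∅ := by
    ext x
    simpa using (h1 x).trans hs1.le
  simp [this]

theorem intervalIntegrable_real_lt (P : Measure ℝ) [IsProbabilityMeasure P] (h : ℝ → ℝ) (a b : ℝ) :
    IntervalIntegrable (fun s => P.real {x | s < h x}) volume a b := by
  refine Antitone.intervalIntegrable fun s t hst => ?_
  exact measureReal_mono fun x hx => lt_of_le_of_lt hst hx

/-- By the layer cake formula the difference is an average over levels in `[0, 1]` of differences on
superlevel sets. -/
theorem abs_integral_sub_integral_le_dTV (P Q : Measure ℝ) [IsProbabilityMeasure P]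
    [IsProbabilityMeasure Q] {h : ℝ → ℝ} (hh : Measurable h) (h0 : ∀ x, 0 ≤ h x)
    (h1 : ∀ x, h x ≤ 1) : |∫ x, h x ∂P - ∫ x, h x ∂Q| ≤ dTV P Q := by
  rw [integral_eq_intervalIntegral_real_lt P hh h0 h1,
    integral_eq_intervalIntegral_real_lt Q hh h0 h1, ← intervalIntegral.integral_sub
      (intervalIntegrable_real_lt P h 0 1) (intervalIntegrable_real_lt Q h 0 1)]
  have := intervalIntegral.norm_integral_le_of_norm_le_const (a := 0) (b := 1) (C := dTV P Q)
    (f := fun s => P.real {x | s < h x} - Q.real {x | s < h x})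
    fun s _ => abs_real_sub_real_le_dTV P Q (measurableSet_lt measurable_const hh)
  simpa using this

theorem re_charFun_eq_integral_cos (P : Measure ℝ) [IsProbabilityMeasure P] (ξ : ℝ) :
    (charFun P ξ).re = ∫ x, Real.cos (ξ * x) ∂P := by
  rw [charFun_apply_real, ← RCLike.re_eq_complex_re, ← integral_re]
  · refine integral_congr_ae (Eventually.of_forall fun x => ?_)
    simp only [RCLike.re_eq_complex_re]
    rw [← Complex.ofReal_mul, Complex.exp_ofReal_mul_I_re]
  · refine Integrable.of_bound (by fun_prop) 1 (Eventually.of_forall fun x => ?_)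
    rw [← Complex.ofReal_mul, Complex.norm_exp_ofReal_mul_I]

theorem integrable_cos_mul (P : Measure ℝ) [IsProbabilityMeasure P] (ξ : ℝ) :
    Integrable (fun x => Real.cos (ξ * x)) P :=
  Integrable.of_bound (by fun_prop) 1 (Eventually.of_forall fun x => Real.abs_cos_le_one _)

/-- The test function `(1 + cos (ξx))/2` takes values in `[0, 1]`; undoing the rescaling costs the
factor 2. -/
theorem abs_re_charFun_sub_le (P Q : Measure ℝ) [IsProbabilityMeasure P]
    [IsProbabilityMeasure Q] (ξ : ℝ) :
    |(charFun P ξ).re - (charFun Q ξ).re| ≤ 2 * dTV P Q := by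
  have key : ∀ ν : Measure ℝ, IsProbabilityMeasure ν →
      (charFun ν ξ).re = 2 * (∫ x, (1 + Real.cos (ξ * x)) / 2 ∂ν) - 1 := by
    intro ν _
    rw [re_charFun_eq_integral_cos, integral_div,
      integral_add (integrable_const _) (integrable_cos_mul ν ξ)]
    simp
    ring
  have := abs_integral_sub_integral_le_dTV P Q (h := fun x => (1 + Real.cos (ξ * x)) / 2)
    (by fun_prop) (fun x => by linarith [Real.neg_one_le_cos (ξ * x)])
    (fun x => by linarith [Real.cos_le_one (ξ * x)])
  rw [key P inferInstance, key Q inferInstance]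
  calc _ = |2 * (∫ x, (1 + Real.cos (ξ * x)) / 2 ∂P - ∫ x, (1 + Real.cos (ξ * x)) / 2 ∂Q)| := by
        congr 1; ring
    _ ≤ _ := by
        rw [abs_mul, abs_of_pos two_pos]
        gcongr

theorem re_charFun_gaussianReal (v : ℝ≥0) (ξ : ℝ) :
    (charFun (gaussianReal 0 v) ξ).re = gauss v ξ := by
  rw [charFun_gaussianReal, gauss]
  have : ((ξ : ℂ) * ((0 : ℝ) : ℂ) * Complex.I - v * ξ ^ 2 / 2) =
      ((-((v : ℝ) * ξ ^ 2 / 2) : ℝ) : ℂ) := by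
    push_cast
    ring
  rw [this, Complex.exp_ofReal_re]

/-- The even part of a solution of the Kac equation solves the real equation: the odd part
does not contribute to the collision gain. -/
theorem IsKacSolution.isRealKacSolution_re {μ₀ : Measure ℝ} {μ : ℝ → Measure ℝ}
    (hμ : IsKacSolution μ₀ μ) :
    IsRealKacSolution (fun ξ => (charFun μ₀ ξ).re) (fun t ξ => (charFun (μ t) ξ).re) where
  initial := by rw [hμ.initial]
  abs_le_one t ht ξ := by
    have := hμ.isProbabilityMeasure t ht
    exact (Complex.abs_re_le_norm _).trans (norm_charFun_le_one ξ)
  continuous t ht := by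
    have := hμ.isProbabilityMeasure t ht
    exact Complex.continuous_re.comp continuous_charFun
  continuousOn ξ := Complex.continuous_re.comp_continuousOn (hμ.continuousOn ξ)
  hasDerivAt ξ t ht := by
    have := hμ.isProbabilityMeasure t ht.le
    have hc : Continuous (charFun (μ t)) := continuous_charFun
    have hre : Continuous fun ξ => (charFun (μ t) ξ).re := Complex.continuous_re.comp hc
    have him : Continuous fun ξ => (charFun (μ t) ξ).im := Complex.continuous_im.comp hc
    have h1 : HasDerivAt (fun s => (charFun (μ s) ξ).re) _ t :=
      Complex.reCLM.hasFDerivAt.comp_hasDerivAt t (hμ.hasDerivAt ξ t ht)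
    convert! h1 using 1
    -- The reflection `θ ↦ 2π - θ` flips only the sine, and the imaginary part is odd, so the
    -- integral equals its negative.
    have hodd : ∫ θ in (0 : ℝ)..(2 * Real.pi), (charFun (μ t) (ξ * Real.cos θ)).im *
        (charFun (μ t) (ξ * Real.sin θ)).im = 0 := by
      have h2 := intervalIntegral.integral_comp_sub_left (a := 0) (b := 2 * Real.pi)
        (fun θ => (charFun (μ t) (ξ * Real.cos θ)).im * (charFun (μ t) (ξ * Real.sin θ)).im)
        (2 * Real.pi)
      simp only [Real.cos_two_pi_sub, Real.sin_two_pi_sub, mul_neg, charFun_neg,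
        Complex.conj_im, intervalIntegral.integral_neg, sub_self, sub_zero] at h2
      linarith
    have hre_int : (∫ θ in (0 : ℝ)..(2 * Real.pi),
        charFun (μ t) (ξ * Real.cos θ) * charFun (μ t) (ξ * Real.sin θ)).re =
        ∫ θ in (0 : ℝ)..(2 * Real.pi),
        (charFun (μ t) (ξ * Real.cos θ)).re * (charFun (μ t) (ξ * Real.sin θ)).re := by
      have h3 := Complex.reCLM.intervalIntegral_comp_comm (a := 0) (b := 2 * Real.pi)
        (μ := volume)
        (f := fun θ => charFun (μ t) (ξ * Real.cos θ) * charFun (μ t) (ξ * Real.sin θ))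
        (Continuous.intervalIntegrable (by fun_prop) _ _)
      simp only [Complex.reCLM_apply, Complex.mul_re] at h3
      rw [← h3, intervalIntegral.integral_sub (Continuous.intervalIntegrable (by fun_prop) _ _)
        (Continuous.intervalIntegrable (by fun_prop) _ _), hodd, sub_zero]
    have hcast : (1 / (2 * (Real.pi : ℂ))) = ((1 / (2 * Real.pi) : ℝ) : ℂ) := by
      push_cast
      rfl
    rw [Complex.reCLM_apply, hcast, Complex.sub_re, Complex.re_ofReal_mul, hre_int]

/-! ### Moments and fourth-order expansions. -/

theorem memLp_id_four {P : Measure ℝ} (hm4 : Integrable (fun x : ℝ => x ^ 4) P) :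
    MemLp id ((4 : ℕ) : ℝ≥0∞) P := by
  rw [← integrable_norm_rpow_iff (by fun_prop) (by norm_num) (by norm_num)]
  refine hm4.congr (Eventually.of_forall fun x => ?_)
  simp only [id, Real.norm_eq_abs, ENNReal.toReal_natCast, Real.rpow_natCast]
  exact ((by decide : Even 4).pow_abs x).symm

theorem integrable_pow_of_fourth {P : Measure ℝ} [IsFiniteMeasure P]
    (hm4 : Integrable (fun x : ℝ => x ^ 4) P) {n : ℕ} (hn : n ≤ 4) :
    Integrable (fun x : ℝ => x ^ n) P := by
  have h : MemLp id (n : ℝ≥0∞) P := (memLp_id_four hm4).mono_exponent (by exact_mod_cast hn)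
  rcases Nat.eq_zero_or_pos n with rfl | h0
  · simp
  · have h1 : Integrable (fun x : ℝ => ‖x‖ ^ n) P := h.integrable_norm_pow h0.ne'
    refine h1.mono (by fun_prop) (Eventually.of_forall fun x => ?_)
    simp

/-- Fourth-order expansion of the real part of a characteristic function. -/
theorem re_charFun_sub_isLittleO (P : Measure ℝ) [IsProbabilityMeasure P]
    (hm4 : Integrable (fun x : ℝ => x ^ 4) P) :
    (fun ξ => (charFun P ξ).re -
      (1 - (∫ x, x ^ 2 ∂P) * ξ ^ 2 / 2 + (∫ x, x ^ 4 ∂P) * ξ ^ 4 / 24)) =o[𝓝 0]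
      fun ξ : ℝ => ξ ^ 4 := by
  have hL := memLp_id_four hm4
  have hT : (fun x => charFun P x - taylorWithinEval (charFun P) 4 Set.univ 0 x) =o[𝓝 0]
      fun x : ℝ => (x - 0) ^ 4 := taylor_isLittleO_univ (contDiff_charFun hL)
  refine (Asymptotics.IsBigO.of_bound 1 (Eventually.of_forall fun ξ => ?_)).trans_isLittleO
    (hT.trans_isBigO (Asymptotics.IsBigO.of_bound 1 (Eventually.of_forall fun ξ => by simp)))
  rw [one_mul, Real.norm_eq_abs]
  refine le_trans (le_of_eq ?_) (Complex.abs_re_le_norm _)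
  congr 1
  rw [taylorWithinEval_charFun_zero hL, Complex.sub_re]
  congr 1
  -- The first and third moments carry odd powers of `I` and drop out of the real part, so no
  -- centering is needed.
  simp only [Finset.sum_range_succ, Finset.sum_range_zero, mul_pow, Complex.I_sq, Complex.I_pow_four,
    Complex.I_pow_three]
  simp [Nat.factorial, ← Complex.ofReal_pow]
  ring

theorem gauss_sub_isLittleO (s : ℝ) :
    (fun ξ => gauss s ξ - (1 - s * ξ ^ 2 / 2 + s ^ 2 * ξ ^ 4 / 8)) =o[𝓝 0]
      fun ξ : ℝ => ξ ^ 4 := by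
  have h6 : (fun ξ => gauss s ξ - (1 - s * ξ ^ 2 / 2 + s ^ 2 * ξ ^ 4 / 8)) =O[𝓝 0]
      fun ξ : ℝ => ξ ^ 6 := by
    have hlim : Tendsto (fun ξ : ℝ => |(-(s * ξ ^ 2 / 2))|) (𝓝 0) (𝓝 0) := by
      have : Continuous fun ξ : ℝ => |(-(s * ξ ^ 2 / 2))| := by fun_prop
      simpa using this.tendsto 0
    refine Asymptotics.IsBigO.of_bound (|s| ^ 3) ?_
    filter_upwards [hlim.eventually (gt_mem_nhds one_pos)] with ξ hξ
    have := Real.exp_bound hξ.le (n := 3) (by norm_num)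
    simp only [Finset.sum_range_succ, Finset.sum_range_zero, Nat.factorial] at this
    norm_num at this
    have h1 : gauss s ξ - (1 - s * ξ ^ 2 / 2 + s ^ 2 * ξ ^ 4 / 8) =
        Real.exp (-(s * ξ ^ 2 / 2)) - (1 + -(s * ξ ^ 2 / 2) + (s * ξ ^ 2 / 2) ^ 2 / 2) := by
      unfold gauss
      ring
    have h2 : |s * ξ ^ 2 / 2| ^ 3 = |s| ^ 3 * ξ ^ 6 / 8 := by
      rw [abs_div, abs_mul, abs_of_nonneg (sq_nonneg ξ), abs_of_pos (two_pos : (0 : ℝ) < 2)]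
      ring
    have h3 : 0 ≤ |s| ^ 3 * ξ ^ 6 := by
      have : (0 : ℝ) ≤ ξ ^ 6 := by positivity
      positivity
    rw [Real.norm_eq_abs, Real.norm_eq_abs, abs_of_nonneg (by positivity : (0 : ℝ) ≤ ξ ^ 6), h1]
    refine le_trans ?_ (show |s| ^ 3 * ξ ^ 6 / 8 ≤ _ by linarith)
    rw [← h2]
    exact this.trans (mul_le_of_le_one_right (by positivity) (by norm_num))
  exact h6.trans_isLittleO (Asymptotics.isLittleO_pow_pow (by norm_num))

theorem integral_symmetrization (P : Measure ℝ) [IsProbabilityMeasure P] {h : ℝ → ℝ}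
    (hm : Measurable h) (hi : Integrable h P) (hi' : Integrable (fun x => h (-x)) P) :
    ∫ x, h x ∂(symmetrization P) = (∫ x, h x ∂P + ∫ x, h (-x) ∂P) / 2 := by
  have hn : Measurable fun x : ℝ => -x := measurable_neg
  unfold symmetrization
  rw [integral_smul_measure, integral_add_measure hi
    ((integrable_map_measure hm.aestronglyMeasurable hn.aemeasurable).2 hi'),
    integral_map hn.aemeasurable hm.aestronglyMeasurable]
  simp
  ring

/-- Symmetrizing kills the mean and preserves even moments. -/
theorem fourthCumulant_symmetrization (P : Measure ℝ) [IsProbabilityMeasure P]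
    (hm4 : Integrable (fun x : ℝ => x ^ 4) P) :
    fourthCumulant (symmetrization P) = (∫ x, x ^ 4 ∂P) - 3 * (∫ x, x ^ 2 ∂P) ^ 2 := by
  have h1 : Integrable (fun x : ℝ => x) P := by
    simpa using integrable_pow_of_fourth hm4 (n := 1) (by norm_num)
  have h2 := integrable_pow_of_fourth hm4 (n := 2) (by norm_num)
  have e1 : ∫ x, x ∂(symmetrization P) = 0 := by
    rw [integral_symmetrization P (h := fun x => x) measurable_id h1 h1.neg]
    rw [integral_neg]
    simp
  have e2 : ∫ x, x ^ 2 ∂(symmetrization P) = ∫ x, x ^ 2 ∂P := by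
    rw [integral_symmetrization P (by fun_prop) h2 (by simpa using h2)]
    simp
  have e4 : ∫ x, x ^ 4 ∂(symmetrization P) = ∫ x, x ^ 4 ∂P := by
    rw [integral_symmetrization P (by fun_prop) hm4
      (by simpa [(by decide : Even 4).neg_pow] using hm4)]
    simp [(by decide : Even 4).neg_pow]
  simp [fourthCumulant, e1, e2, e4]

end KacEquation

theorem theorem1 (μ₀ : Measure ℝ) [IsProbabilityMeasure μ₀]
    (hm4 : Integrable (fun x : ℝ => x ^ 4) μ₀)
    (hκ : KacEquation.fourthCumulant (KacEquation.symmetrization μ₀) ≠ 0)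
    (σ : ℝ≥0) (hσ : (σ : ℝ) ^ 2 = ∫ x, x ^ 2 ∂μ₀) :
    ∃ C : ℝ, 0 < C ∧
      ∀ μ : ℝ → Measure ℝ, KacEquation.IsKacSolution μ₀ μ →
        (∀ t : ℝ, 0 ≤ t →
          C * Real.exp (-(1 / 4) * t) ≤ KacEquation.dTV (μ t) (gaussianReal 0 (σ ^ 2))) ∧
        (∀ (D : ℝ) (ρ : ℝ → ℝ), Tendsto ρ atTop (𝓝 0) →
          ¬ ∀ t : ℝ, 0 ≤ t →
            KacEquation.dTV (μ t) (gaussianReal 0 (σ ^ 2)) ≤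
              D * Real.exp (-(1 / 4) * t) * ρ t) := by
  set s : ℝ := (σ : ℝ) ^ 2 with hs
  -- This is the difference `m₄/24 - σ⁴/8` of the quartic Taylor coefficients, `m₄` being the fourth
  -- moment; the quadratic ones agree by `hσ`.
  set k : ℝ := KacEquation.fourthCumulant (KacEquation.symmetrization μ₀) / 24 with hk
  have hg : ∀ ξ, (charFun (gaussianReal 0 (σ ^ 2)) ξ).re = KacEquation.gauss s ξ := fun ξ => by
    rw [KacEquation.re_charFun_gaussianReal, hs, NNReal.coe_pow]
  have ho : (fun ξ => (charFun μ₀ ξ).re - KacEquation.gauss s ξ - k * ξ ^ 4) =o[𝓝 0]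
      fun ξ : ℝ => ξ ^ 4 := by
    refine ((KacEquation.re_charFun_sub_isLittleO μ₀ hm4).sub
      (KacEquation.gauss_sub_isLittleO s)).congr_left fun ξ => ?_
    rw [hk, KacEquation.fourthCumulant_symmetrization μ₀ hm4, ← hσ]
    ring
  obtain ⟨ξ, c, hc, hlow⟩ := KacEquation.exists_exp_le_abs_sub_gauss (sq_nonneg (σ : ℝ))
    (div_ne_zero hκ (by norm_num))
    (fun ξ => (Complex.abs_re_le_norm _).trans (norm_charFun_le_one ξ)) ho
  refine ⟨c / 2, by positivity, fun μ hμ => ?_⟩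
  have hbound : ∀ t : ℝ, 0 ≤ t →
      c / 2 * Real.exp (-(1 / 4) * t) ≤ KacEquation.dTV (μ t) (gaussianReal 0 (σ ^ 2)) := by
    intro t ht
    have := hμ.isProbabilityMeasure t ht
    have h1 := hlow _ hμ.isRealKacSolution_re t ht
    have h2 := KacEquation.abs_re_charFun_sub_le (μ t) (gaussianReal 0 (σ ^ 2)) ξ
    rw [hg] at h2
    linarith
  refine ⟨hbound, fun D ρ hρ hle => ?_⟩
  have hlim : Tendsto (fun t => D * ρ t) atTop (𝓝 (D * 0)) := hρ.const_mul D
  -- Cancelling `exp (-t/4)` leaves `c/2 ≤ D ρ(t)`, and the right side tends to 0.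
  have hge : c / 2 ≤ D * 0 := by
    refine ge_of_tendsto hlim ?_
    filter_upwards [eventually_ge_atTop 0] with t ht
    have h1 := (hbound t ht).trans (hle t ht)
    refine le_of_mul_le_mul_right ?_ (Real.exp_pos (-(1 / 4) * t))
    linarith
  linarith
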